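/- **Setting.** Let $\Omega\subset\mathbb R^3$ be a bounded open set, $W^1=W^2=L^2(\Omega;\mathbb R^3)$, $W^3=L^2(\Omega)$, with $L^2$ inner product $\langle\cdot,\cdot\rangle$ and norm $\|\cdot\|$. Let $V^1\subset H(\mathrm{curl},\Omega)$ and $V^2\subset H(\mathrm{div},\Omega)$ be subspaces, dense in $W^1$ and $W^2$, such that the restrictions $d=d^1:V^1\to W^2$ of the weak curl and $d=d^2:V^2\to W^3$ of the weak divergence are closed operators and $d^1V^1\subset V^2$; put $V^3=W^3$ (for example $V^1=H(\mathrm{curl},\Omega)$, $V^2=H(\mathrm{div},\Omega)$, or $V^1=H_0(\mathrm{curl},\Omega)$, $V^2=H_0(\mathrm{div},\Omega)$). Let $d^*:V^*_2\to W^1$ and $d^*:V^*_3\to W^2$ be the Hilbert space adjoints of $(d^1,V^1)$ and $(d^2,V^2)$, where $V^*_2\subset W^2$ and $V^*_3\subset W^3$ are their domains, and let $\mathfrak H^3=(dV^2)^\perp\subset W^3$. All domains carry graph norms: $\|u\|_V=\|u\|+\|du\|$ on $V^1,V^2$, $\|v\|+\|d^*v\|$ on $V_2^*,V_3^*$, $\|u\|+\|du\|+\|d^*u\|$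 on $V^2\cap V_2^*$; on $V^3$ and $\mathfrak H^3$ the norm is $\|\cdot\|$. Let $\nu>0$ and let $l_3:W^1\to W^2$, $l_5:W^2\to W^2$ be bounded linear maps with Hilbert space adjoints $l_3^*,l_5^*$. Define the bounded linear operators $$\overline{L_1},\ \overline{L_1'}:\ (V^2\cap V^*_2)\times(V^*_3\cap\mathfrak H^{3\perp})\longrightarrow (V^*_2\times(W^3\cap\mathfrak H^{3\perp}))'$$ by $$\overline{L_1}(u,p)(v,q)=\langle\nu d^*u,d^*v\rangle+\langle l_3d^*u+l_5u-d^*p,v\rangle+\langle du,q\rangle,$$ $$\overline{L_1'}(u,p)(v,q)=\langle\nu d^*u+l_3^*u,d^*v\rangle+\langle l_5^*u+d^*p,v\rangle+\langle-du,q\rangle.$$ Write $W=W^2\times(W^3\cap\mathfrak H^{3\perp})$, regarded as a subspace of $(V^*_2\times(W^3\cap\mathfrak H^{3\perp}))'$ through $(f_2,f_3)\mapsto\big((v,q)\mapsto\langle f_2,v\rangle+\langle f_3,q\rangle\big)$, and let a subscript $2$ on an operator denote the first component ($u$) of its value. On $V=V^1\times V^2\times V^3\times\mathfrak H^3$, with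 norm $\|\mathbf u\|_V=\|u_1\|_V+\|u_2\|_V+\|u_3\|+\|u_p\|$ for $\mathbf u=(u_1,u_2,u_3,u_p)$, let $$B(\mathbf u,\mathbf v)=\langle u_1,v_1\rangle-\langle u_2,dv_1\rangle+\nu\langle du_1,v_2\rangle-\langle u_3,dv_2\rangle+\langle du_2,v_3\rangle+\langle l_3u_1,v_2\rangle+\langle l_5u_2,v_2\rangle+\langle u_p,v_3\rangle+\langle u_3,v_p\rangle.$$ **Theorem.** Assume that $\overline{L_1}$ and $\overline{L_1'}$ are bounded isomorphisms (with bounded inverses), put $K=(\overline{L_1'})^{-1}$, and assume the regularity property $$d^*(\overline{L_1}^{-1})_2(W)\subset V^1,\qquad(\nu d^*+l_3^*)(K)_2(W)\subset V^1.$$ Then the mixed problem is well-posed: there is a constant $c>0$ such that for all $f_2\in W^2$ and $f_3\in W^3$ (in particular for all $(f_2,f_3)\in W$) there is exactly one $\mathbf u\in V$ with $$B(\mathbf u,\mathbf v)=\langle f_2,v_2\rangle+\langle f_3,v_3\rangle\qquad\text{for all }\mathbf v\in V,$$ and it satisfies $\|\mathbf u\|_V\le c\,(\|f_2\|+\|f_3\|)$.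 More generally, there is a constant $c>0$ such that for every bounded linear functional $F$ on $V$ there is exactly one $\mathbf u\in V$ with $B(\mathbf u,\mathbf v)=F(\mathbf v)$ for all $\mathbf v\in V$, and $\|\mathbf u\|_V\le c\,\|F\|_{V'}$. -/

import Mathlib

open MeasureTheory Filter Topology
open scoped ContDiff InnerProductSpace

noncomputable section

namespace VorticityMixed

/-! ### The `L²` spaces and the weak exterior derivatives on an open set of `ℝ³` -/

/-- Euclidean space `ℝ³`. -/
abbrev R3 : Type := EuclideanSpace ℝ (Fin 3)

/-- `L²(Ω; ℝ³)`: the space `W¹ = W²` of square integrable vector fields. -/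
abbrev L2Vec (Ω : Set R3) : Type := Lp R3 2 (volume.restrict Ω)

/-- `L²(Ω)`: the space `W³` of square integrable functions. -/
abbrev L2Scal (Ω : Set R3) : Type := Lp ℝ 2 (volume.restrict Ω)

/-- Smooth maps with compact support contained in `Ω`. -/
structure IsTest {F : Type} [NormedAddCommGroup F] [NormedSpace ℝ F]
    (Ω : Set R3) (φ : R3 → F) : Prop where
  smooth : ContDiff ℝ ∞ φ
  compact : HasCompactSupport φ
  supp : tsupport φ ⊆ Ω

/-- The classical partial derivative `∂ᵢ φⱼ` of a vector field at `x`. -/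
def partialD (φ : R3 → R3) (i j : Fin 3) (x : R3) : ℝ :=
  fderiv ℝ φ x (EuclideanSpace.single i 1) j

/-- The classical curl of a vector field. -/
def curl (φ : R3 → R3) (x : R3) : R3 :=
  !₂[partialD φ 1 2 x - partialD φ 2 1 x,
     partialD φ 2 0 x - partialD φ 0 2 x,
     partialD φ 0 1 x - partialD φ 1 0 x]

/-- `w` is the weak curl of `u` in `Ω`. -/
def IsWeakCurl (Ω : Set R3) (u w : L2Vec Ω) : Prop :=
  ∀ φ : R3 → R3, IsTest Ω φ → ∫ x in Ω, ⟪u x, curl φ x⟫_ℝ = ∫ x in Ω, ⟪w x, φ x⟫_ℝ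

/-- `w` is the weak divergence of `u` in `Ω`. -/
def IsWeakDiv (Ω : Set R3) (u : L2Vec Ω) (w : L2Scal Ω) : Prop :=
  ∀ φ : R3 → ℝ, IsTest Ω φ → ∫ x in Ω, ⟪u x, gradient φ x⟫_ℝ = - ∫ x in Ω, w x * φ x

section Pairing

variable {Ω : Set R3} {F : Type} [NormedAddCommGroup F] [InnerProductSpace ℝ F]

theorem integral_inner_eq (u : Lp F 2 (volume.restrict Ω)) {ψ : R3 → F} (hc : Continuous ψ)
    (hs : HasCompactSupport ψ) :
    ∫ x in Ω, ⟪u x, ψ x⟫_ℝ =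
      ⟪u, (hc.memLp_of_hasCompactSupport hs : MemLp ψ 2 (volume.restrict Ω)).toLp ψ⟫_ℝ := by
  rw [L2.inner_def]
  refine integral_congr_ae ?_
  filter_upwards [(hc.memLp_of_hasCompactSupport hs :
    MemLp ψ 2 (volume.restrict Ω)).coeFn_toLp] with x hx
  rw [hx]

theorem continuous_curl {φ : R3 → R3} (h : ContDiff ℝ ∞ φ) : Continuous (curl φ) := by
  have h1 : Continuous (fderiv ℝ φ) := h.continuous_fderiv (by simp)
  unfold curl partialD
  refine (PiLp.continuous_toLp 2 _).comp ?_
  refine continuous_pi fun i => ?_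
  fin_cases i <;> simp <;> fun_prop

theorem hasCompactSupport_curl {φ : R3 → R3} (h : HasCompactSupport φ) :
    HasCompactSupport (curl φ) := by
  have h1 : HasCompactSupport (fderiv ℝ φ) := h.fderiv ℝ
  refine h1.mono ?_
  intro x hx hx'
  apply hx
  have : fderiv ℝ φ x = 0 := hx'
  ext i
  fin_cases i <;> simp [curl, partialD, this]

theorem continuous_gradient {φ : R3 → ℝ} (h : ContDiff ℝ ∞ φ) : Continuous (gradient φ) := by
  have h1 : Continuous (fderiv ℝ φ) := h.continuous_fderiv (by simp)
  unfold gradient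
  fun_prop

theorem hasCompactSupport_gradient {φ : R3 → ℝ} (h : HasCompactSupport φ) :
    HasCompactSupport (gradient φ) := by
  have h1 : HasCompactSupport (fderiv ℝ φ) := h.fderiv ℝ
  refine h1.mono ?_
  intro x hx hx'
  apply hx
  have : fderiv ℝ φ x = 0 := hx'
  simp [gradient, this]

theorem isWeakCurl_iff (u w : L2Vec Ω) : IsWeakCurl Ω u w ↔ ∀ φ : R3 → R3, ∀ h : IsTest Ω φ,
    ⟪u, ((continuous_curl h.smooth).memLp_of_hasCompactSupport
      (hasCompactSupport_curl h.compact)).toLp (curl φ)⟫_ℝ =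
    ⟪w, (h.smooth.continuous.memLp_of_hasCompactSupport h.compact).toLp φ⟫_ℝ := by
  refine forall₂_congr fun φ h => ?_
  rw [integral_inner_eq u (continuous_curl h.smooth) (hasCompactSupport_curl h.compact),
    integral_inner_eq w h.smooth.continuous h.compact]

theorem isWeakDiv_iff (u : L2Vec Ω) (w : L2Scal Ω) :
    IsWeakDiv Ω u w ↔ ∀ φ : R3 → ℝ, ∀ h : IsTest Ω φ,
    ⟪u, ((continuous_gradient h.smooth).memLp_of_hasCompactSupport
      (hasCompactSupport_gradient h.compact)).toLp (gradient φ)⟫_ℝ =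
    - ⟪w, (h.smooth.continuous.memLp_of_hasCompactSupport h.compact).toLp φ⟫_ℝ := by
  refine forall₂_congr fun φ h => ?_
  rw [integral_inner_eq u (continuous_gradient h.smooth) (hasCompactSupport_gradient h.compact),
    ← integral_inner_eq w h.smooth.continuous h.compact]
  simp [mul_comm]

end Pairing

/-- The graph of the weak curl. -/
def curlGraph (Ω : Set R3) : Submodule ℝ (L2Vec Ω × L2Vec Ω) where
  carrier := {x | IsWeakCurl Ω x.1 x.2}
  zero_mem' := by
    simp only [Set.mem_ofPred_eq, isWeakCurl_iff]
    intro φ h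
    simp
  add_mem' {x y} hx hy := by
    simp only [Set.mem_ofPred_eq, isWeakCurl_iff] at *
    intro φ h
    simp only [Prod.fst_add, Prod.snd_add, inner_add_left, hx φ h, hy φ h]
  smul_mem' c x hx := by
    simp only [Set.mem_ofPred_eq, isWeakCurl_iff] at *
    intro φ h
    simp only [Prod.smul_fst, Prod.smul_snd, real_inner_smul_left, hx φ h]

/-- The graph of the weak divergence. -/
def divGraph (Ω : Set R3) : Submodule ℝ (L2Vec Ω × L2Scal Ω) where
  carrier := {x | IsWeakDiv Ω x.1 x.2}
  zero_mem' := by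
    simp only [Set.mem_ofPred_eq, isWeakDiv_iff]
    intro φ h
    simp
  add_mem' {x y} hx hy := by
    simp only [Set.mem_ofPred_eq, isWeakDiv_iff] at *
    intro φ h
    simp only [Prod.fst_add, Prod.snd_add, inner_add_left, hx φ h, hy φ h]
    ring
  smul_mem' c x hx := by
    simp only [Set.mem_ofPred_eq, isWeakDiv_iff] at *
    intro φ h
    simp only [Prod.smul_fst, Prod.smul_snd, real_inner_smul_left, hx φ h]
    ring

/-- The weak curl as an unbounded operator on `L²(Ω; ℝ³)`; its domain is `H(curl, Ω)`. -/
def weakCurl (Ω : Set R3) : L2Vec Ω →ₗ.[ℝ] L2Vec Ω := (curlGraph Ω).toLinearPMap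

/-- The weak divergence as an unbounded operator from `L²(Ω; ℝ³)` to `L²(Ω)`; its domain is
`H(div, Ω)`. -/
def weakDiv (Ω : Set R3) : L2Vec Ω →ₗ.[ℝ] L2Scal Ω := (divGraph Ω).toLinearPMap

/-- An `L²` function whose pairings with all test functions vanish is zero; hence weak derivatives
are unique and the two operators above have the intended values. -/
theorem eq_zero_of_forall_test {Ω : Set R3} (hΩ : IsOpen Ω) {F : Type} [NormedAddCommGroup F]
    [InnerProductSpace ℝ F] [CompleteSpace F] (w : Lp F 2 (volume.restrict Ω))
    (h : ∀ φ : R3 → F, IsTest Ω φ → ∫ x in Ω, ⟪w x, φ x⟫_ℝ = 0) : w = 0 := by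
  have hloc : LocallyIntegrable w (volume.restrict Ω) :=
    (Lp.memLp w).locallyIntegrable (by norm_num)
  have key := hΩ.ae_eq_zero_of_integral_contDiff_smul_eq_zero (μ := volume.restrict Ω)
    (f := w) (hloc.locallyIntegrableOn Ω) (fun g hg hgc hgs => by
      have hgi : Integrable (fun x => g x • w x) (volume.restrict Ω) :=
        hloc.integrable_smul_left_of_hasCompactSupport hg.continuous hgc
      refine ext_inner_left ℝ fun v => ?_
      rw [← integral_inner hgi v, inner_zero_right]
      have hφ : IsTest Ω (fun x => g x • v) :=
        ⟨hg.smul contDiff_const, hgc.smul_right,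
          (closure_mono (Function.support_smul_subset_left g (fun _ => v))).trans hgs⟩
      rw [← h _ hφ]
      refine integral_congr_ae (ae_of_all _ fun x => ?_)
      simp only [real_inner_smul_right, real_inner_smul_left, real_inner_comm])
  rw [Lp.eq_zero_iff_ae_eq_zero]
  filter_upwards [key, ae_restrict_mem hΩ.measurableSet] with x hx hxm using hx hxm

theorem mem_graph_weakCurl {Ω : Set R3} (hΩ : IsOpen Ω) (x : L2Vec Ω × L2Vec Ω) :
    x ∈ (weakCurl Ω).graph ↔ IsWeakCurl Ω x.1 x.2 := by
  unfold weakCurl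
  rw [Submodule.toLinearPMap_graph_eq]
  · rfl
  · intro y hy h0
    refine eq_zero_of_forall_test hΩ _ fun φ hφ => ?_
    have hy' : IsWeakCurl Ω y.1 y.2 := hy
    rw [← hy' φ hφ, h0, integral_inner_eq 0 (continuous_curl hφ.smooth)
      (hasCompactSupport_curl hφ.compact), inner_zero_left]

theorem mem_graph_weakDiv {Ω : Set R3} (hΩ : IsOpen Ω) (x : L2Vec Ω × L2Scal Ω) :
    x ∈ (weakDiv Ω).graph ↔ IsWeakDiv Ω x.1 x.2 := by
  unfold weakDiv
  rw [Submodule.toLinearPMap_graph_eq]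
  · rfl
  · intro y hy h0
    refine eq_zero_of_forall_test hΩ _ fun φ hφ => ?_
    have hy' := (isWeakDiv_iff y.1 y.2).1 hy φ hφ
    rw [integral_inner_eq _ hφ.smooth.continuous hφ.compact]
    rw [h0, inner_zero_left] at hy'
    linarith

/-! ### The domain complex -/

/-- A choice of the domain complex `V¹ → V² → V³ = L²(Ω)` inside the `L²` de Rham complex of `Ω`:
`d¹` and `d²` are restrictions of the weak curl and of the weak divergence to dense subspaces
`V¹ ⊆ H(curl, Ω)` and `V² ⊆ H(div, Ω)`, they are closed operators and `d¹` maps `V¹` into `V²`.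
The choice of `V¹` and `V²` encodes the essential boundary conditions. -/
structure DeRhamDomain (Ω : Set R3) where
  d1 : L2Vec Ω →ₗ.[ℝ] L2Vec Ω
  d2 : L2Vec Ω →ₗ.[ℝ] L2Scal Ω
  d1_le : d1 ≤ weakCurl Ω
  d2_le : d2 ≤ weakDiv Ω
  dense1 : Dense (d1.domain : Set (L2Vec Ω))
  dense2 : Dense (d2.domain : Set (L2Vec Ω))
  closed1 : d1.IsClosed
  closed2 : d2.IsClosed
  maps_domain : ∀ u : d1.domain, d1 u ∈ d2.domain

/-! ### Domains of unbounded operators with the graph norm -/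

section GraphSpace

variable {E F G : Type} [NormedAddCommGroup E] [NormedSpace ℝ E] [NormedAddCommGroup F]
  [NormedSpace ℝ F] [NormedAddCommGroup G] [NormedSpace ℝ G]

/-- The domain of an unbounded operator `T`, with the norm `‖x‖ + ‖T x‖`. -/
def GraphSpace (T : E →ₗ.[ℝ] F) : Type := T.domain

namespace GraphSpace

variable (T : E →ₗ.[ℝ] F)

instance : AddCommGroup (GraphSpace T) := inferInstanceAs (AddCommGroup T.domain)

instance : Module ℝ (GraphSpace T) := inferInstanceAs (Module ℝ T.domain)

variable {T}

/-- The inclusion of the domain of `T` in the ambient space. -/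
def val : GraphSpace T →ₗ[ℝ] E := T.domain.subtype

/-- The operator `T` on its domain. -/
def op : GraphSpace T →ₗ[ℝ] F := T.toFun

instance : Norm (GraphSpace T) := ⟨fun x => ‖val x‖ + ‖op x‖⟩

theorem norm_def (x : GraphSpace T) : ‖x‖ = ‖val x‖ + ‖op x‖ := rfl

theorem core : NormedSpace.Core ℝ (GraphSpace T) where
  norm_nonneg x := by rw [norm_def]; positivity
  norm_smul c x := by simp only [norm_def, map_smul, norm_smul]; ring
  norm_triangle x y := by
    simp only [norm_def, map_add]
    linarith [norm_add_le (val x) (val y), norm_add_le (op x) (op y)]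
  norm_eq_zero_iff x := by
    constructor
    · intro h
      rw [norm_def] at h
      have h1 : ‖val x‖ = 0 := by linarith [norm_nonneg (val x), norm_nonneg (op x)]
      exact Subtype.ext (norm_eq_zero.1 h1)
    · rintro rfl
      simp [norm_def]

instance : NormedAddCommGroup (GraphSpace T) := NormedAddCommGroup.ofCore core

instance : NormedSpace ℝ (GraphSpace T) := NormedSpace.ofCore core

theorem norm_eq (x : GraphSpace T) : ‖x‖ = ‖val x‖ + ‖op x‖ := rfl

theorem norm_val_le (x : GraphSpace T) : ‖val x‖ ≤ ‖x‖ := by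
  rw [norm_eq]; linarith [norm_nonneg (op x)]

theorem norm_op_le (x : GraphSpace T) : ‖op x‖ ≤ ‖x‖ := by
  rw [norm_eq]; linarith [norm_nonneg (val x)]

end GraphSpace

/-- The operator `x ↦ (S x, T x)` on the intersection of the domains of `S` and `T`; the target
carries the norm `‖y‖ + ‖z‖`. -/
def pairOp (S : E →ₗ.[ℝ] F) (T : E →ₗ.[ℝ] G) : E →ₗ.[ℝ] WithLp 1 (F × G) where
  domain := S.domain ⊓ T.domain
  toFun := (WithLp.linearEquiv 1 ℝ (F × G)).symm.toLinearMap ∘ₗ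
    (S.toFun ∘ₗ Submodule.inclusion inf_le_left).prod
      (T.toFun ∘ₗ Submodule.inclusion inf_le_right)

end GraphSpace

/-! ### The function spaces of the problem -/

namespace DeRhamDomain

variable {Ω : Set R3} (C : DeRhamDomain Ω)

/-- `V¹` with the norm `‖u‖ + ‖d u‖`. -/
abbrev V1 : Type := GraphSpace C.d1

/-- `V²` with the norm `‖u‖ + ‖d u‖`. -/
abbrev V2 : Type := GraphSpace C.d2

/-- The codifferential `d* : V*₂ → W¹`, the Hilbert space adjoint of `(d¹, V¹)`. -/
def dstar2 : L2Vec Ω →ₗ.[ℝ] L2Vec Ω := C.d1.adjoint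

/-- The codifferential `d* : V*₃ → W²`, the Hilbert space adjoint of `(d², V²)`. -/
def dstar3 : L2Scal Ω →ₗ.[ℝ] L2Vec Ω := C.d2.adjoint

/-- The harmonic forms `ℌ³`: as `d` vanishes on `V³ = W³`, they are the orthogonal complement
of `𝔅³ = d V²` in `W³`. -/
def harm3 : Submodule ℝ (L2Scal Ω) := (LinearMap.range C.d2.toFun)ᗮ

/-- `V*₂` with the norm `‖v‖ + ‖d* v‖`. -/
abbrev VStar2 : Type := GraphSpace C.dstar2

/-- `V² ∩ V*₂` with the norm `‖u‖ + ‖d u‖ + ‖d* u‖`. -/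
abbrev VCap2 : Type := GraphSpace (pairOp C.d2 C.dstar2)

variable {C} in
/-- The exterior derivative `d u ∈ W³` of `u ∈ V² ∩ V*₂`. -/
def capD (u : C.VCap2) : L2Scal Ω := (GraphSpace.op u).fst

variable {C} in
/-- The codifferential `d* u ∈ W¹` of `u ∈ V² ∩ V*₂`. -/
def capDstar (u : C.VCap2) : L2Vec Ω := (GraphSpace.op u).snd

/-- `V*₃ ∩ ℌ³ᗮ` with the norm `‖p‖ + ‖d* p‖`. -/
abbrev VStar3 : Submodule ℝ (GraphSpace C.dstar3) := C.harm3ᗮ.comap GraphSpace.val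

/-- The space `(V² ∩ V*₂) × (V*₃ ∩ ℌ³ᗮ)` on which the primal operators act. -/
abbrev PrimalSpace : Type := C.VCap2 × C.VStar3

/-- The space `V*₂ × (W³ ∩ ℌ³ᗮ)`, whose dual is the target of the primal operators. -/
abbrev PrimalTest : Type := C.VStar2 × C.harm3ᗮ

/-! ### The primal operators -/

open GraphSpace (val op)

/-- The bilinear form
`⟨ν d* u, d* v⟩ + ⟨l₃ d* u + l₅ u - d* p, v⟩ + ⟨d u, q⟩`. -/
def primalForm (ν : ℝ) (l3 l5 : L2Vec Ω →L[ℝ] L2Vec Ω) (x : C.PrimalSpace) (y : C.PrimalTest) :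
    ℝ :=
  ⟪ν • capDstar x.1, op y.1⟫_ℝ
    + ⟪l3 (capDstar x.1) + l5 (val x.1) - op (x.2 : GraphSpace C.dstar3), val y.1⟫_ℝ
    + ⟪capD x.1, (y.2 : L2Scal Ω)⟫_ℝ

/-- The bilinear form
`⟨ν d* u + l₃* u, d* v⟩ + ⟨l₅* u + d* p, v⟩ + ⟨-d u, q⟩`. -/
def dualForm (ν : ℝ) (l3 l5 : L2Vec Ω →L[ℝ] L2Vec Ω) (x : C.PrimalSpace) (y : C.PrimalTest) :
    ℝ :=
  ⟪ν • capDstar x.1 + l3.adjoint (val x.1), op y.1⟫_ℝ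
    + ⟪l5.adjoint (val x.1) + op (x.2 : GraphSpace C.dstar3), val y.1⟫_ℝ
    + ⟪-capD x.1, (y.2 : L2Scal Ω)⟫_ℝ

section Bounds

variable {C}

theorem capD_add (u v : C.VCap2) : capD (u + v) = capD u + capD v := by simp [capD]

theorem capD_smul (c : ℝ) (u : C.VCap2) : capD (c • u) = c • capD u := by simp [capD]

theorem capDstar_add (u v : C.VCap2) : capDstar (u + v) = capDstar u + capDstar v := by
  simp [capDstar]

theorem capDstar_smul (c : ℝ) (u : C.VCap2) : capDstar (c • u) = c • capDstar u := by
  simp [capDstar]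

theorem norm_cap (u : C.VCap2) : ‖u‖ = ‖val u‖ + (‖capD u‖ + ‖capDstar u‖) := by
  rw [GraphSpace.norm_eq, WithLp.prod_norm_eq_of_L1]; rfl

theorem norm_val_cap_le (u : C.VCap2) : ‖val u‖ ≤ ‖u‖ := GraphSpace.norm_val_le u

theorem norm_capD_le (u : C.VCap2) : ‖capD u‖ ≤ ‖u‖ := by
  rw [norm_cap]; linarith [norm_nonneg (val u), norm_nonneg (capDstar u)]

theorem norm_capDstar_le (u : C.VCap2) : ‖capDstar u‖ ≤ ‖u‖ := by
  rw [norm_cap]; linarith [norm_nonneg (val u), norm_nonneg (capD u)]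

theorem norm_op_star3_le (p : C.VStar3) : ‖op (p : GraphSpace C.dstar3)‖ ≤ ‖p‖ :=
  GraphSpace.norm_op_le _

theorem abs_inner_le {H : Type} [NormedAddCommGroup H] [InnerProductSpace ℝ H] {a b : H}
    {r s : ℝ} (ha : ‖a‖ ≤ r) (hb : ‖b‖ ≤ s) : |⟪a, b⟫_ℝ| ≤ r * s :=
  (abs_real_inner_le_norm a b).trans
    (mul_le_mul ha hb (norm_nonneg _) ((norm_nonneg _).trans ha))

theorem abs_primalForm_le (ν : ℝ) (l3 l5 : L2Vec Ω →L[ℝ] L2Vec Ω) (x : C.PrimalSpace)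
    (y : C.PrimalTest) :
    ‖C.primalForm ν l3 l5 x y‖ ≤ (|ν| + ‖l3‖ + ‖l5‖ + 2) * ‖x‖ * ‖y‖ := by
  have hu : ‖x.1‖ ≤ ‖x‖ := norm_fst_le x
  have hp : ‖x.2‖ ≤ ‖x‖ := norm_snd_le x
  have hv : ‖y.1‖ ≤ ‖y‖ := norm_fst_le y
  have hq : ‖(y.2 : L2Scal Ω)‖ ≤ ‖y‖ := norm_snd_le y
  have e1 : ‖ν • capDstar x.1‖ ≤ |ν| * ‖x‖ := by
    rw [norm_smul, Real.norm_eq_abs]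
    exact mul_le_mul_of_nonneg_left ((norm_capDstar_le _).trans hu) (abs_nonneg _)
  have e2 : ‖l3 (capDstar x.1) + l5 (val x.1) - op (x.2 : GraphSpace C.dstar3)‖
      ≤ ‖l3‖ * ‖x‖ + ‖l5‖ * ‖x‖ + ‖x‖ := by
    refine (norm_sub_le _ _).trans (add_le_add ((norm_add_le _ _).trans (add_le_add ?_ ?_)) ?_)
    · exact l3.le_opNorm_of_le ((norm_capDstar_le _).trans hu)
    · exact l5.le_opNorm_of_le ((norm_val_cap_le _).trans hu)
    · exact (norm_op_star3_le _).trans hp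
  have i1 := abs_inner_le e1 ((GraphSpace.norm_op_le y.1).trans hv)
  have i2 := abs_inner_le e2 ((GraphSpace.norm_val_le y.1).trans hv)
  have i3 := abs_inner_le ((norm_capD_le x.1).trans hu) hq
  rw [Real.norm_eq_abs, primalForm]
  refine (abs_add_three _ _ _).trans ((add_le_add (add_le_add i1 i2) i3).trans (le_of_eq ?_))
  ring

theorem abs_dualForm_le (ν : ℝ) (l3 l5 : L2Vec Ω →L[ℝ] L2Vec Ω) (x : C.PrimalSpace)
    (y : C.PrimalTest) :
    ‖C.dualForm ν l3 l5 x y‖ ≤ (|ν| + ‖l3.adjoint‖ + ‖l5.adjoint‖ + 2) * ‖x‖ * ‖y‖ := by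
  have hu : ‖x.1‖ ≤ ‖x‖ := norm_fst_le x
  have hp : ‖x.2‖ ≤ ‖x‖ := norm_snd_le x
  have hv : ‖y.1‖ ≤ ‖y‖ := norm_fst_le y
  have hq : ‖(y.2 : L2Scal Ω)‖ ≤ ‖y‖ := norm_snd_le y
  have e1 : ‖ν • capDstar x.1 + l3.adjoint (val x.1)‖ ≤ |ν| * ‖x‖ + ‖l3.adjoint‖ * ‖x‖ := by
    refine (norm_add_le _ _).trans (add_le_add ?_ ?_)
    · rw [norm_smul, Real.norm_eq_abs]
      exact mul_le_mul_of_nonneg_left ((norm_capDstar_le _).trans hu) (abs_nonneg _)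
    · exact l3.adjoint.le_opNorm_of_le ((norm_val_cap_le _).trans hu)
  have e2 : ‖l5.adjoint (val x.1) + op (x.2 : GraphSpace C.dstar3)‖
      ≤ ‖l5.adjoint‖ * ‖x‖ + ‖x‖ := by
    refine (norm_add_le _ _).trans (add_le_add ?_ ?_)
    · exact l5.adjoint.le_opNorm_of_le ((norm_val_cap_le _).trans hu)
    · exact (norm_op_star3_le _).trans hp
  have i1 := abs_inner_le e1 ((GraphSpace.norm_op_le y.1).trans hv)
  have i2 := abs_inner_le e2 ((GraphSpace.norm_val_le y.1).trans hv)
  have e3 : ‖-capD x.1‖ ≤ ‖x‖ := by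
    rw [norm_neg]
    exact (norm_capD_le x.1).trans hu
  have i3 := abs_inner_le e3 hq
  rw [Real.norm_eq_abs, dualForm]
  refine (abs_add_three _ _ _).trans ((add_le_add (add_le_add i1 i2) i3).trans (le_of_eq ?_))
  ring

end Bounds

/-- The primal operator `L̄₁ : (V² ∩ V*₂) × (V*₃ ∩ ℌ³ᗮ) → (V*₂ × (W³ ∩ ℌ³ᗮ))'`. -/
def primalOp (ν : ℝ) (l3 l5 : L2Vec Ω →L[ℝ] L2Vec Ω) :
    C.PrimalSpace →L[ℝ] StrongDual ℝ C.PrimalTest :=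
  (LinearMap.mk₂ ℝ (C.primalForm ν l3 l5)
    (fun x x' y => by
      simp only [primalForm, Prod.fst_add, Prod.snd_add, Submodule.coe_add, capD_add,
        capDstar_add, map_add, smul_add, inner_add_left, inner_sub_left]
      ring)
    (fun c x y => by
      simp only [primalForm, Prod.smul_fst, Prod.smul_snd, Submodule.coe_smul, capD_smul,
        capDstar_smul, map_smul, real_inner_smul_left, inner_add_left, inner_sub_left, smul_eq_mul]
      ring)
    (fun x y y' => by
      simp only [primalForm, Prod.fst_add, Prod.snd_add, Submodule.coe_add, map_add,
        inner_add_right]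
      ring)
    (fun c x y => by
      simp only [primalForm, Prod.smul_fst, Prod.smul_snd, Submodule.coe_smul, map_smul,
        real_inner_smul_right, smul_eq_mul]
      ring)).mkContinuous₂ _ (C.abs_primalForm_le ν l3 l5)

/-- The dual operator `L̄₁' : (V² ∩ V*₂) × (V*₃ ∩ ℌ³ᗮ) → (V*₂ × (W³ ∩ ℌ³ᗮ))'`. -/
def dualOp (ν : ℝ) (l3 l5 : L2Vec Ω →L[ℝ] L2Vec Ω) :
    C.PrimalSpace →L[ℝ] StrongDual ℝ C.PrimalTest :=
  (LinearMap.mk₂ ℝ (C.dualForm ν l3 l5)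
    (fun x x' y => by
      simp only [dualForm, Prod.fst_add, Prod.snd_add, Submodule.coe_add, capD_add,
        capDstar_add, map_add, smul_add, inner_add_left, inner_neg_left]
      ring)
    (fun c x y => by
      simp only [dualForm, Prod.smul_fst, Prod.smul_snd, Submodule.coe_smul, capD_smul,
        capDstar_smul, map_smul, real_inner_smul_left, inner_add_left, inner_neg_left, smul_eq_mul]
      ring)
    (fun x y y' => by
      simp only [dualForm, Prod.fst_add, Prod.snd_add, Submodule.coe_add, map_add,
        inner_add_right]
      ring)
    (fun c x y => by
      simp only [dualForm, Prod.smul_fst, Prod.smul_snd, Submodule.coe_smul, map_smul,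
        real_inner_smul_right, smul_eq_mul]
      ring)).mkContinuous₂ _ (C.abs_dualForm_le ν l3 l5)

/-- `f = (f₂, f₃) ∈ W = W² × (W³ ∩ ℌ³ᗮ)` as the functional `(v, q) ↦ ⟨f₂, v⟩ + ⟨f₃, q⟩` on
`V*₂ × (W³ ∩ ℌ³ᗮ)`. -/
def dataFunctional (f2 : L2Vec Ω) (f3 : C.harm3ᗮ) : StrongDual ℝ C.PrimalTest :=
  LinearMap.mkContinuous
    { toFun := fun y => ⟪f2, val y.1⟫_ℝ + ⟪(f3 : L2Scal Ω), (y.2 : L2Scal Ω)⟫_ℝ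
      map_add' := fun y y' => by
        simp only [Prod.fst_add, Prod.snd_add, Submodule.coe_add, map_add, inner_add_right]
        ring
      map_smul' := fun c y => by
        simp only [Prod.smul_fst, Prod.smul_snd, Submodule.coe_smul, map_smul,
          real_inner_smul_right, smul_eq_mul, RingHom.id_apply]
        ring }
    (‖f2‖ + ‖f3‖) (fun y => by
      have i1 := abs_inner_le (le_refl ‖f2‖) ((GraphSpace.norm_val_le y.1).trans (norm_fst_le y))
      have i2 := abs_inner_le (le_refl ‖(f3 : L2Scal Ω)‖)
        (show ‖(y.2 : L2Scal Ω)‖ ≤ ‖y‖ from norm_snd_le y)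
      refine (abs_add_le _ _).trans ((add_le_add i1 i2).trans (le_of_eq ?_))
      rw [add_mul]; rfl)

/-- The regularity assumption
`d* (L̄₁⁻¹)₂ (W) ⊆ V¹` and `(ν d* + l₃*) (K)₂ (W) ⊆ V¹`, with `K = (L̄₁')⁻¹`. -/
def Regularity (ν : ℝ) (l3 l5 : L2Vec Ω →L[ℝ] L2Vec Ω) : Prop :=
  (∀ (f2 : L2Vec Ω) (f3 : C.harm3ᗮ),
    capDstar ((C.primalOp ν l3 l5).inverse (C.dataFunctional f2 f3)).1 ∈ C.d1.domain) ∧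
  ∀ (f2 : L2Vec Ω) (f3 : C.harm3ᗮ),
    ν • capDstar ((C.dualOp ν l3 l5).inverse (C.dataFunctional f2 f3)).1
      + l3.adjoint (val ((C.dualOp ν l3 l5).inverse (C.dataFunctional f2 f3)).1) ∈ C.d1.domain

/-! ### The mixed problem -/

/-- `V = V¹ × V² × V³ × ℌ³`, with `V³ = W³ = L²(Ω)`. -/
abbrev MixedSpace : Type := C.V1 × C.V2 × L2Scal Ω × C.harm3

/-- The norm `‖u₁‖_V + ‖u₂‖_V + ‖u₃‖_V + ‖u_p‖_V` on `V`; here `‖·‖_V = ‖·‖` on `V³` and on `ℌ³`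
because `d = 0` on `V³`. -/
def normV (u : C.MixedSpace) : ℝ := ‖u.1‖ + ‖u.2.1‖ + ‖u.2.2.1‖ + ‖u.2.2.2‖

/-- The bilinear form `B` of the mixed problem. -/
def mixedForm (ν : ℝ) (l3 l5 : L2Vec Ω →L[ℝ] L2Vec Ω) : C.MixedSpace → C.MixedSpace → ℝ
  | (u1, u2, u3, up), (v1, v2, v3, vp) =>
    ⟪val u1, val v1⟫_ℝ - ⟪val u2, op v1⟫_ℝ
      + ν * ⟪op u1, val v2⟫_ℝ - ⟪u3, op v2⟫_ℝ + ⟪op u2, v3⟫_ℝ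
      + ⟪l3 (val u1), val v2⟫_ℝ + ⟪l5 (val u2), val v2⟫_ℝ
      + ⟪(up : L2Scal Ω), v3⟫_ℝ + ⟪u3, (vp : L2Scal Ω)⟫_ℝ

/-- `u ∈ V` solves `B(u, v) = R(v)` for all `v ∈ V`. -/
def IsMixedSolution (ν : ℝ) (l3 l5 : L2Vec Ω →L[ℝ] L2Vec Ω) (R : C.MixedSpace → ℝ)
    (u : C.MixedSpace) : Prop :=
  ∀ v : C.MixedSpace, C.mixedForm ν l3 l5 u v = R v

/-- The right-hand side `v ↦ ⟨f₂, v₂⟩ + ⟨f₃, v₃⟩` of the mixed problem. -/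
def mixedData (f2 : L2Vec Ω) (f3 : L2Scal Ω) (v : C.MixedSpace) : ℝ :=
  ⟪f2, val v.2.1⟫_ℝ + ⟪f3, v.2.2.1⟫_ℝ

end DeRhamDomain

end VorticityMixed

end

/-!
Testing the mixed problem with one component at a time turns it into its strong form, which for
right-hand sides in `L²` says precisely that `u₁ = d* u₂`, that `u_p` is the `ℌ³`-component of `f₃`,
and that `(u₂, u₃)` solves the primal problem. The primal isomorphism then gives uniqueness, and
existence as well, since regularity places `d* u₂` in `V¹`. A general functional on `V` is the sum
of an `L²` right-hand side and of `B(u, ·)` for an explicit `u` made of Riesz representatives. Hence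
`B` induces a bijection of the Banach space `V` onto `V'`, and the stability constant comes from the
bounded inverse theorem.
-/

namespace VorticityMixed

section ClosedOperators

variable {𝕜 E F : Type*} [RCLike 𝕜] [NormedAddCommGroup E] [InnerProductSpace 𝕜 E]
  [NormedAddCommGroup F] [InnerProductSpace 𝕜 F]

/-- The graph of an unbounded operator as a subspace of the Hilbert sum `E ⊕ F`, the inner product
on which makes orthogonality and the Riesz theorem available for graphs. -/
def hilbertGraph (T : E →ₗ.[𝕜] F) : Submodule 𝕜 (WithLp 2 (E × F)) :=
  T.graph.comap (WithLp.linearEquiv 2 𝕜 (E × F)).toLinearMap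

theorem mem_hilbertGraph {T : E →ₗ.[𝕜] F} {z : WithLp 2 (E × F)} :
    z ∈ hilbertGraph T ↔ (z.fst, z.snd) ∈ T.graph := Iff.rfl

variable [CompleteSpace E]

theorem snd_mem_adjoint_domain_of_mem_orthogonal {T : E →ₗ.[𝕜] F} {z : WithLp 2 (E × F)}
    (hz : z ∈ (hilbertGraph T)ᗮ) : z.snd ∈ T.adjoint.domain := by
  refine T.mem_adjoint_domain_of_exists _ ⟨-z.fst, fun x => ?_⟩
  have h := (Submodule.mem_orthogonal' _ _).1 hz (WithLp.toLp 2 ((x : E), T x))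
    (mem_hilbertGraph.2 (T.mem_graph x))
  rw [WithLp.prod_inner_apply] at h
  rw [inner_neg_left]
  exact neg_eq_of_add_eq_zero_right h

variable [CompleteSpace F]

theorem completeSpace_hilbertGraph {T : E →ₗ.[𝕜] F} (hT : T.IsClosed) :
    CompleteSpace (hilbertGraph T) :=
  (IsClosed.preimage (WithLp.prod_continuous_ofLp 2 E F) hT).completeSpace_coe

/-- If `y` is orthogonal to the domain of the adjoint, then `(0, y)` is orthogonal to the orthogonal
complement of the graph, hence lies in the graph, and so `y = T 0`. -/
theorem dense_adjoint_domain {T : E →ₗ.[𝕜] F} (hT : T.IsClosed) :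
    Dense (T.adjoint.domain : Set F) := by
  rw [Submodule.dense_iff_topologicalClosure_eq_top, Submodule.topologicalClosure_eq_top_iff,
    Submodule.eq_bot_iff]
  intro y hy
  have := completeSpace_hilbertGraph hT
  have hmem : WithLp.toLp 2 ((0 : E), y) ∈ hilbertGraph T := by
    rw [← Submodule.orthogonal_orthogonal (hilbertGraph T), Submodule.mem_orthogonal]
    intro z hz
    have hzy := (Submodule.mem_orthogonal _ _).1 hy _ (snd_mem_adjoint_domain_of_mem_orthogonal hz)
    simpa [WithLp.prod_inner_apply] using hzy
  exact T.graph_fst_eq_zero_snd (mem_hilbertGraph.1 hmem) rfl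

end ClosedOperators

section BoundedOperators

theorem exists_norm_le_mul_norm_of_bijective {𝕜 X Y : Type*} [NontriviallyNormedField 𝕜]
    [CompleteSpace 𝕜] [NormedAddCommGroup X] [NormedSpace 𝕜 X] [CompleteSpace X]
    [NormedAddCommGroup Y] [NormedSpace 𝕜 Y] {T : X →L[𝕜] StrongDual 𝕜 Y}
    (hT : Function.Bijective T) : ∃ c : ℝ, 0 < c ∧ ∀ x, ‖x‖ ≤ c * ‖T x‖ := by
  obtain ⟨-, K, hK⟩ := T.bijective_iff_dense_range_and_antilipschitz.1 hT
  refine ⟨K + 1, by positivity, fun x => (hK.le_mul_norm (map_zero T) x).trans ?_⟩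
  gcongr
  exact le_add_of_nonneg_right zero_le_one

variable {X Y H : Type*} [NormedAddCommGroup X] [NormedSpace ℝ X] [NormedAddCommGroup Y]
  [NormedSpace ℝ Y] [NormedAddCommGroup H] [InnerProductSpace ℝ H]

/-- The bounded bilinear form `(x, y) ↦ ⟪S x, T y⟫`, as an operator into the dual. -/
noncomputable def innerForm (S : X →L[ℝ] H) (T : Y →L[ℝ] H) : X →L[ℝ] StrongDual ℝ Y :=
  (isBoundedBilinearMap_inner (𝕜 := ℝ)).toContinuousLinearMap.bilinearComp S T

end BoundedOperators

namespace GraphSpace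

section Continuity

variable {E F : Type} [NormedAddCommGroup E] [NormedSpace ℝ E] [NormedAddCommGroup F]
  [NormedSpace ℝ F] {T : E →ₗ.[ℝ] F}

/-- `val` as a bounded operator. -/
noncomputable def valL : GraphSpace T →L[ℝ] E :=
  val.mkContinuous 1 fun x => by simpa only [one_mul] using norm_val_le x

/-- `op` as a bounded operator. -/
noncomputable def opL : GraphSpace T →L[ℝ] F :=
  op.mkContinuous 1 fun x => by simpa only [one_mul] using norm_op_le x

end Continuity

variable {E F : Type} [NormedAddCommGroup E] [InnerProductSpace ℝ E] [NormedAddCommGroup F]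
  [InnerProductSpace ℝ F]

/-- The domain of `T` with its graph norm `‖x‖ + ‖T x‖` is isomorphic, though not isometric, to the
graph of `T` in the Hilbert sum. -/
noncomputable def equivHilbertGraph (T : E →ₗ.[ℝ] F) : GraphSpace T ≃L[ℝ] hilbertGraph T :=
  LinearEquiv.toContinuousLinearEquivOfBounds
    { toFun x := ⟨WithLp.toLp 2 (val x, op x), mem_hilbertGraph.2 (T.mem_graph x)⟩
      invFun z := ⟨z.1.fst, LinearPMap.mem_domain_of_mem_graph (mem_hilbertGraph.1 z.2)⟩
      map_add' x y := by ext1; simp [← WithLp.toLp_add]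
      map_smul' c x := by ext1; simp [← WithLp.toLp_smul]
      left_inv _ := rfl
      right_inv z := Subtype.ext <| WithLp.ofLp_injective 2 <| Prod.ext rfl <|
        (T.image_iff _).2 (mem_hilbertGraph.1 z.2) |>.symm }
    1 2
    (fun x => by
      change ‖WithLp.toLp 2 (val x, op x)‖ ≤ 1 * ‖x‖
      rw [WithLp.prod_norm_eq_of_L2, norm_eq, one_mul, Real.sqrt_le_iff]
      refine ⟨by positivity, ?_⟩
      change ‖val x‖ ^ 2 + ‖op x‖ ^ 2 ≤ (‖val x‖ + ‖op x‖) ^ 2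
      nlinarith [norm_nonneg (val x), norm_nonneg (op x)])
    (fun z => by
      rw [two_mul]
      exact add_le_add (WithLp.norm_fst_le E z.1) <|
        ((T.image_iff _).2 (mem_hilbertGraph.1 z.2) ▸ WithLp.norm_snd_le E z.1 :))

variable [CompleteSpace E] {T : E →ₗ.[ℝ] F}

theorem exists_adjoint_iff (hT : Dense (T.domain : Set E)) {x : F} {w : E} :
    (∃ y : GraphSpace T.adjoint, val y = x ∧ op y = w) ↔
      ∀ v : GraphSpace T, ⟪w, val v⟫_ℝ = ⟪x, op v⟫_ℝ := by
  constructor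
  · rintro ⟨y, rfl, rfl⟩ v
    exact LinearPMap.adjoint_isFormalAdjoint hT y v
  · intro h
    exact ⟨⟨x, T.mem_adjoint_domain_of_exists x ⟨w, h⟩⟩, rfl, LinearPMap.adjoint_apply_eq hT _ h⟩

variable [CompleteSpace F]

theorem completeSpace (hT : T.IsClosed) : CompleteSpace (GraphSpace T) :=
  (completeSpace_congr (e := (equivHilbertGraph T).toEquiv)
    (equivHilbertGraph T).isUniformEmbedding).2 (completeSpace_hilbertGraph hT)

theorem exists_riesz (hT : T.IsClosed) (f : StrongDual ℝ (GraphSpace T)) :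
    ∃ a : GraphSpace T, ∀ x, f x = ⟪val a, val x⟫_ℝ + ⟪op a, op x⟫_ℝ := by
  have := completeSpace_hilbertGraph hT
  let e := equivHilbertGraph T
  obtain ⟨z, hz⟩ := (InnerProductSpace.toDual ℝ (hilbertGraph T)).surjective
    (f ∘L (e.symm : hilbertGraph T →L[ℝ] GraphSpace T))
  refine ⟨e.symm z, fun x => ?_⟩
  calc f x = InnerProductSpace.toDual ℝ (hilbertGraph T) z (e x) := by simp [hz]
    _ = ⟪e (e.symm z), e x⟫_ℝ := by
      rw [e.apply_symm_apply, InnerProductSpace.toDual_apply_apply]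
    _ = ⟪val (e.symm z), val x⟫_ℝ + ⟪op (e.symm z), op x⟫_ℝ := rfl

end GraphSpace

namespace DeRhamDomain

open GraphSpace (val op valL opL)

variable {Ω : Set R3} (C : DeRhamDomain Ω)

instance : CompleteSpace C.V1 := GraphSpace.completeSpace C.closed1

instance : CompleteSpace C.V2 := GraphSpace.completeSpace C.closed2

instance : CompleteSpace C.harm3 :=
  inferInstanceAs (CompleteSpace (LinearMap.range C.d2.toFun)ᗮ)

variable {C}

theorem op_mem_harm3_orthogonal (v : C.V2) : op v ∈ C.harm3ᗮ :=
  Submodule.le_orthogonal_orthogonal _ (LinearMap.mem_range_self _ v)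

theorem inner_harm3_op (h : C.harm3) (v : C.V2) : ⟪(h : L2Scal Ω), op v⟫_ℝ = 0 :=
  Submodule.inner_right_of_mem_orthogonal h.2 (op_mem_harm3_orthogonal v)

variable {ν : ℝ} {l3 l5 : L2Vec Ω →L[ℝ] L2Vec Ω}

/-! ### The mixed problem as an operator equation -/

variable (C) in
/-- The right-hand side `C.mixedData f2 f3` as a bounded functional on `V`. -/
noncomputable def mixedDataFunctional (f2 : L2Vec Ω) (f3 : L2Scal Ω) : StrongDual ℝ C.MixedSpace :=
  let π2 : C.MixedSpace →L[ℝ] C.V2 := .fst ℝ _ _ ∘L .snd ℝ _ _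
  let π3 : C.MixedSpace →L[ℝ] L2Scal Ω := .fst ℝ _ _ ∘L .snd ℝ _ _ ∘L .snd ℝ _ _
  innerSL ℝ f2 ∘L valL ∘L π2 + innerSL ℝ f3 ∘L π3

theorem coe_mixedDataFunctional (f2 : L2Vec Ω) (f3 : L2Scal Ω) :
    ⇑(C.mixedDataFunctional f2 f3) = C.mixedData f2 f3 := rfl

theorem norm_mixedDataFunctional_le (f2 : L2Vec Ω) (f3 : L2Scal Ω) :
    ‖C.mixedDataFunctional f2 f3‖ ≤ ‖f2‖ + ‖f3‖ := by
  refine ContinuousLinearMap.opNorm_le_bound _ (by positivity) fun v => ?_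
  have h2 : ‖val v.2.1‖ ≤ ‖v‖ :=
    (GraphSpace.norm_val_le _).trans ((norm_fst_le v.2).trans (norm_snd_le v))
  have h3 : ‖v.2.2.1‖ ≤ ‖v‖ :=
    (norm_fst_le v.2.2).trans ((norm_snd_le v.2).trans (norm_snd_le v))
  calc ‖⟪f2, val v.2.1⟫_ℝ + ⟪f3, v.2.2.1⟫_ℝ‖
      ≤ ‖f2‖ * ‖v‖ + ‖f3‖ * ‖v‖ :=
        (norm_add_le _ _).trans (add_le_add (abs_inner_le le_rfl h2) (abs_inner_le le_rfl h3))
    _ = (‖f2‖ + ‖f3‖) * ‖v‖ := (add_mul _ _ _).symm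

variable (C ν l3 l5) in
/-- The operator `V → V'` induced by the bilinear form `B` of the mixed problem. -/
noncomputable def mixedOp : C.MixedSpace →L[ℝ] StrongDual ℝ C.MixedSpace :=
  let π1 : C.MixedSpace →L[ℝ] C.V1 := .fst ℝ _ _
  let π2 : C.MixedSpace →L[ℝ] C.V2 := .fst ℝ _ _ ∘L .snd ℝ _ _
  let π3 : C.MixedSpace →L[ℝ] L2Scal Ω := .fst ℝ _ _ ∘L .snd ℝ _ _ ∘L .snd ℝ _ _
  let πp : C.MixedSpace →L[ℝ] L2Scal Ω :=
    C.harm3.subtypeL ∘L .snd ℝ _ _ ∘L .snd ℝ _ _ ∘L .snd ℝ _ _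
  innerForm (valL ∘L π1) (valL ∘L π1) - innerForm (valL ∘L π2) (opL ∘L π1)
    + ν • innerForm (opL ∘L π1) (valL ∘L π2) - innerForm π3 (opL ∘L π2)
    + innerForm (opL ∘L π2) π3
    + innerForm (l3 ∘L valL ∘L π1) (valL ∘L π2) + innerForm (l5 ∘L valL ∘L π2) (valL ∘L π2)
    + innerForm πp π3 + innerForm π3 πp

theorem mixedOp_apply (u v : C.MixedSpace) :
    C.mixedOp ν l3 l5 u v = C.mixedForm ν l3 l5 u v := rfl

theorem isMixedSolution_iff_mixedOp_eq {F : StrongDual ℝ C.MixedSpace} {u : C.MixedSpace} :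
    C.IsMixedSolution ν l3 l5 F u ↔ C.mixedOp ν l3 l5 u = F := by
  simp only [IsMixedSolution, ContinuousLinearMap.ext_iff, mixedOp_apply]

theorem normV_le (u : C.MixedSpace) : C.normV u ≤ 4 * ‖u‖ := by
  have h1 := norm_fst_le u
  have h2 := (norm_fst_le u.2).trans (norm_snd_le u)
  have h3 := (norm_fst_le u.2.2).trans ((norm_snd_le u.2).trans (norm_snd_le u))
  have h4 := (norm_snd_le u.2.2).trans ((norm_snd_le u.2).trans (norm_snd_le u))
  rw [normV]
  linarith

theorem exists_solution_bound_of_bijective_mixedOp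
    (hB : Function.Bijective (C.mixedOp ν l3 l5)) :
    ∃ c : ℝ, 0 < c ∧ ∀ F : StrongDual ℝ C.MixedSpace,
      ∃ u : C.MixedSpace, C.IsMixedSolution ν l3 l5 F u ∧
        (∀ u' : C.MixedSpace, C.IsMixedSolution ν l3 l5 F u' → u' = u) ∧
        C.normV u ≤ c * ‖F‖ := by
  obtain ⟨c, hc, hbound⟩ := exists_norm_le_mul_norm_of_bijective hB
  refine ⟨4 * c, by positivity, fun F => ?_⟩
  obtain ⟨u, rfl⟩ := hB.surjective F
  refine ⟨u, isMixedSolution_iff_mixedOp_eq.2 rfl,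
    fun u' hu' => hB.injective (isMixedSolution_iff_mixedOp_eq.1 hu'), ?_⟩
  linarith [normV_le u, hbound u]

/-! ### Strong forms of the primal and mixed problems -/

theorem primalForm_eq_of_val_eq_capDstar {x : C.PrimalSpace} {u1 : C.V1}
    (hu1 : val u1 = capDstar x.1) (y : C.PrimalTest) :
    C.primalForm ν l3 l5 x y =
      ⟪ν • op u1 + l3 (val u1) + l5 (val x.1) - op (x.2 : GraphSpace C.dstar3), val y.1⟫_ℝ
        + ⟪capD x.1, (y.2 : L2Scal Ω)⟫_ℝ := by
  have hadj : ⟪val u1, op y.1⟫_ℝ = ⟪op u1, val y.1⟫_ℝ := by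
    rw [real_inner_comm, real_inner_comm (val y.1)]
    exact (GraphSpace.exists_adjoint_iff C.dense1).1 ⟨y.1, rfl, rfl⟩ u1
  simp only [primalForm, ← hu1, inner_add_left, inner_sub_left, real_inner_smul_left, hadj]
  ring

theorem capD_mem_harm3_orthogonal (u : C.VCap2) : capD u ∈ C.harm3ᗮ :=
  op_mem_harm3_orthogonal ⟨val u, u.2.1⟩

theorem primalOp_eq_dataFunctional_iff {x : C.PrimalSpace} {f2 : L2Vec Ω} {f3 : C.harm3ᗮ}
    {u1 : C.V1} (hu1 : val u1 = capDstar x.1) :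
    C.primalOp ν l3 l5 x = C.dataFunctional f2 f3 ↔
      ν • op u1 + l3 (val u1) + l5 (val x.1) - op (x.2 : GraphSpace C.dstar3) = f2 ∧
        capD x.1 = f3 := by
  have hform : C.primalOp ν l3 l5 x = C.dataFunctional f2 f3 ↔ ∀ y : C.PrimalTest,
      C.primalForm ν l3 l5 x y = ⟪f2, val y.1⟫_ℝ + ⟪(f3 : L2Scal Ω), (y.2 : L2Scal Ω)⟫_ℝ :=
    ContinuousLinearMap.ext_iff (f := C.primalOp ν l3 l5 x) (g := C.dataFunctional f2 f3)
  simp only [hform, primalForm_eq_of_val_eq_capDstar hu1]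
  refine ⟨fun h => ⟨?_, ?_⟩, ?_⟩
  · refine (dense_adjoint_domain C.closed1).eq_of_inner_left ℝ fun v hv => ?_
    have hv2 := h (⟨v, hv⟩, 0)
    simp only [ZeroMemClass.coe_zero, inner_zero_right, add_zero] at hv2
    exact hv2
  · have hq := h (0, ⟨capD x.1 - f3, sub_mem (capD_mem_harm3_orthogonal x.1) f3.2⟩)
    simp only [map_zero, inner_zero_right, zero_add] at hq
    rwa [← sub_eq_zero, ← inner_sub_left, inner_self_eq_zero, sub_eq_zero] at hq
  · rintro ⟨rfl, h3⟩ y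
    rw [h3]

theorem isMixedSolution_mixedData_iff {f2 : L2Vec Ω} {f3 : L2Scal Ω} {u1 : C.V1} {u2 : C.V2}
    {u3 : L2Scal Ω} {up : C.harm3} :
    C.IsMixedSolution ν l3 l5 (C.mixedData f2 f3) (u1, u2, u3, up) ↔
      (∃ y : C.VStar2, val y = val u2 ∧ op y = val u1) ∧
      (∃ p : C.VStar3, val (p : GraphSpace C.dstar3) = u3 ∧
        op (p : GraphSpace C.dstar3) = ν • op u1 + l3 (val u1) + l5 (val u2) - f2) ∧
      op u2 + up = f3 := by
  constructor
  · intro h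
    refine ⟨(GraphSpace.exists_adjoint_iff C.dense1).2 fun v1 => ?_, ?_, ?_⟩
    · have h1 := h (v1, 0, 0, 0)
      simp only [mixedForm, mixedData, map_zero, inner_zero_right, Submodule.coe_zero, mul_zero,
        add_zero, sub_zero] at h1
      exact sub_eq_zero.1 h1
    · have hu3 : u3 ∈ C.harm3ᗮ := (Submodule.mem_orthogonal' _ _).2 fun q hq => by
        simpa [mixedForm, mixedData] using h (0, 0, 0, ⟨q, hq⟩)
      obtain ⟨p, rfl, hp⟩ := (GraphSpace.exists_adjoint_iff C.dense2 (x := u3)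
        (w := ν • op u1 + l3 (val u1) + l5 (val u2) - f2)).2 fun v2 => by
          have h2 := h (0, v2, 0, 0)
          simp only [mixedForm, mixedData, map_zero, inner_zero_right, Submodule.coe_zero,
            add_zero, sub_zero, zero_add] at h2
          simp only [inner_add_left, inner_sub_left, real_inner_smul_left]
          linarith
      exact ⟨⟨p, hu3⟩, rfl, hp⟩
    · refine ext_inner_right ℝ fun v3 => ?_
      simpa [mixedForm, mixedData, inner_add_left] using h (0, 0, v3, 0)
  · rintro ⟨hy, ⟨p, rfl, hp⟩, rfl⟩ ⟨v1, v2, v3, vp⟩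
    have h1 : ⟪val u1, val v1⟫_ℝ = ⟪val u2, op v1⟫_ℝ :=
      (GraphSpace.exists_adjoint_iff C.dense1).1 hy v1
    have h2 : ⟪ν • op u1 + l3 (val u1) + l5 (val u2) - f2, val v2⟫_ℝ =
        ⟪val (p : GraphSpace C.dstar3), op v2⟫_ℝ :=
      (GraphSpace.exists_adjoint_iff C.dense2).1 ⟨(p : GraphSpace C.dstar3), rfl, hp⟩ v2
    have hp' : ⟪val (p : GraphSpace C.dstar3), (vp : L2Scal Ω)⟫_ℝ = 0 :=
      Submodule.inner_left_of_mem_orthogonal vp.2 p.2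
    simp only [inner_add_left, inner_sub_left, real_inner_smul_left] at h2
    simp only [mixedForm, mixedData, h1, ← h2, hp', inner_add_left]
    ring

/-! ### Bijectivity of the mixed operator -/

theorem exists_vCap2_of_val_eq {u : C.V2} {y : C.VStar2} (h : val y = val u) :
    ∃ x : C.VCap2, val x = val u ∧ capD x = op u ∧ capDstar x = op y := by
  obtain ⟨z, hz⟩ := y
  change z = val u at h
  subst h
  exact ⟨⟨val u, u.2, hz⟩, rfl, rfl, rfl⟩

theorem dataFunctional_zero : C.dataFunctional 0 0 = 0 :=
  ContinuousLinearMap.ext fun y => show ⟪0, val y.1⟫_ℝ + ⟪0, (y.2 : L2Scal Ω)⟫_ℝ = 0 by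
    rw [inner_zero_left, inner_zero_left, add_zero]

/-- A homogeneous mixed solution `(u₁, u₂, u₃, u_p)` has `u₁ = d* u₂`, and `d u₂ = -u_p` vanishes
because `d V²` is orthogonal to `ℌ³`; hence `(u₂, u₃)` lies in the kernel of `L̄₁`. -/
theorem mixedOp_injective (hL : Function.Injective (C.primalOp ν l3 l5)) :
    Function.Injective (C.mixedOp ν l3 l5) := by
  rw [injective_iff_map_eq_zero]
  rintro ⟨u1, u2, u3, up⟩ hu
  have hsol : C.IsMixedSolution ν l3 l5 (C.mixedData 0 0) (u1, u2, u3, up) := fun v => by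
    rw [← mixedOp_apply, hu]
    simp [mixedData]
  obtain ⟨⟨y, hy2, hy1⟩, ⟨p, rfl, hp⟩, h3⟩ := isMixedSolution_mixedData_iff.1 hsol
  obtain ⟨x, hx, hdx, hdsx⟩ := exists_vCap2_of_val_eq hy2
  have hup : (up : L2Scal Ω) = 0 := by
    have h := inner_harm3_op up u2
    rwa [eq_neg_of_add_eq_zero_left h3, inner_neg_right, neg_eq_zero, inner_self_eq_zero] at h
  have hker : C.primalOp ν l3 l5 (x, p) = C.dataFunctional 0 0 := by
    refine (primalOp_eq_dataFunctional_iff (hy1.symm.trans hdsx.symm)).2 ⟨?_, ?_⟩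
    · rw [hp, hx, sub_zero, sub_self]
    · exact hdx.trans (by rwa [hup, add_zero] at h3)
  rw [dataFunctional_zero] at hker
  obtain ⟨rfl, rfl⟩ := Prod.mk_eq_zero.1 ((injective_iff_map_eq_zero _).1 hL _ hker)
  have hu1 : val u1 = 0 := by
    rw [← hy1, ← hdsx]
    simp only [capDstar, map_zero, WithLp.zero_snd]
  have hu2 : val u2 = 0 := by rw [← hx, map_zero]
  exact Prod.ext (Subtype.ext hu1) (Prod.ext (Subtype.ext hu2) (Prod.ext rfl (Subtype.ext hup)))

variable (C ν l3 l5) in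
/-- The half of `Regularity` that concerns `L̄₁`: `d* (L̄₁⁻¹)₂ (W) ⊆ V¹`. -/
def PrimalRegularity : Prop :=
  ∀ (f2 : L2Vec Ω) (f3 : C.harm3ᗮ),
    capDstar ((C.primalOp ν l3 l5).inverse (C.dataFunctional f2 f3)).1 ∈ C.d1.domain

theorem exists_isMixedSolution_mixedData (hL : (C.primalOp ν l3 l5).IsInvertible)
    (hreg : C.PrimalRegularity ν l3 l5) (f2 : L2Vec Ω) (f3 : L2Scal Ω) :
    ∃ u, C.IsMixedSolution ν l3 l5 (C.mixedData f2 f3) u := by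
  obtain ⟨h, hh, q, hq, rfl⟩ := C.harm3.exists_add_mem_mem_orthogonal f3
  obtain ⟨x, hx⟩ : ∃ x, (C.primalOp ν l3 l5).inverse (C.dataFunctional f2 ⟨q, hq⟩) = x := ⟨_, rfl⟩
  have hLx : C.primalOp ν l3 l5 x = C.dataFunctional f2 ⟨q, hq⟩ := by
    rw [← hx, hL.self_apply_inverse]
  let u1 : C.V1 := ⟨capDstar x.1, hx ▸ hreg f2 ⟨q, hq⟩⟩
  let u2 : C.V2 := ⟨val x.1, x.1.2.1⟩
  let y : C.VStar2 := ⟨val x.1, x.1.2.2⟩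
  obtain ⟨e2, e3⟩ := (primalOp_eq_dataFunctional_iff (u1 := u1) rfl).1 hLx
  refine ⟨(u1, u2, val (x.2 : GraphSpace C.dstar3), ⟨h, hh⟩),
    isMixedSolution_mixedData_iff.2 ⟨⟨y, rfl, rfl⟩, ⟨x.2, rfl, ?_⟩, ?_⟩⟩
  · rw [← e2]
    exact (sub_sub_cancel _ _).symm
  · exact (congrArg (· + h) e3).trans (add_comm _ _)

theorem exists_riesz_mixedSpace (F : StrongDual ℝ C.MixedSpace) :
    ∃ (a : C.V1) (b : C.V2) (f : L2Scal Ω) (g : C.harm3), ∀ v1 v2 v3 vp,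
      F (v1, v2, v3, vp) = (⟪val a, val v1⟫_ℝ + ⟪op a, op v1⟫_ℝ)
        + (⟪val b, val v2⟫_ℝ + ⟪op b, op v2⟫_ℝ) + ⟪f, v3⟫_ℝ
        + ⟪(g : L2Scal Ω), (vp : L2Scal Ω)⟫_ℝ := by
  obtain ⟨a, ha⟩ := GraphSpace.exists_riesz C.closed1 (F ∘L .inl ℝ _ _)
  obtain ⟨b, hb⟩ := GraphSpace.exists_riesz C.closed2 (F ∘L .inr ℝ _ _ ∘L .inl ℝ _ _)
  obtain ⟨f, hf⟩ := (InnerProductSpace.toDual ℝ (L2Scal Ω)).surjective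
    (F ∘L .inr ℝ _ _ ∘L .inr ℝ _ _ ∘L .inl ℝ _ _)
  obtain ⟨g, hg⟩ := (InnerProductSpace.toDual ℝ C.harm3).surjective
    (F ∘L .inr ℝ _ _ ∘L .inr ℝ _ _ ∘L .inr ℝ _ _)
  refine ⟨a, b, f, g, fun v1 v2 v3 vp => ?_⟩
  have hv : ((v1, v2, v3, vp) : C.MixedSpace) =
      (v1, 0, 0, 0) + (0, v2, 0, 0) + (0, 0, v3, 0) + (0, 0, 0, vp) := by
    simp only [Prod.mk_add_mk, add_zero, zero_add]
  rw [hv, map_add, map_add, map_add]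
  exact congrArg₂ (· + ·) (congrArg₂ (· + ·) (congrArg₂ (· + ·) (ha v1) (hb v2))
    (DFunLike.congr_fun hf v3).symm) (DFunLike.congr_fun hg vp).symm

/-- The quadruple `(a, -d a, g - d b, 0)`, formed from the Riesz representatives of `F`, accounts
for all parts of `F` that are not `L²` data. -/
theorem exists_eq_mixedOp_add_mixedDataFunctional (ν : ℝ) (l3 l5 : L2Vec Ω →L[ℝ] L2Vec Ω)
    (F : StrongDual ℝ C.MixedSpace) :
    ∃ u f2 f3, F = C.mixedOp ν l3 l5 u + C.mixedDataFunctional f2 f3 := by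
  obtain ⟨a, b, f, g, hF⟩ := exists_riesz_mixedSpace F
  obtain ⟨w, hw⟩ : ∃ w : C.V2, val w = op a := ⟨⟨op a, C.maps_domain a⟩, rfl⟩
  refine ⟨(a, -w, (g : L2Scal Ω) - op b, 0), val b - ν • op a - l3 (val a) + l5 (op a), f + op w,
    ContinuousLinearMap.ext fun v => ?_⟩
  obtain ⟨v1, v2, v3, vp⟩ := v
  have hb : ⟪op b, (vp : L2Scal Ω)⟫_ℝ = 0 := by rw [real_inner_comm, inner_harm3_op]
  rw [add_apply, mixedOp_apply, coe_mixedDataFunctional, hF]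
  simp only [mixedForm, mixedData, map_neg, hw, inner_neg_left, inner_add_left, inner_sub_left,
    real_inner_smul_left, inner_harm3_op, hb, ZeroMemClass.coe_zero, inner_zero_left]
  ring

theorem mixedOp_bijective (hL : (C.primalOp ν l3 l5).IsInvertible)
    (hreg : C.PrimalRegularity ν l3 l5) : Function.Bijective (C.mixedOp ν l3 l5) := by
  refine ⟨mixedOp_injective hL.injective, fun F => ?_⟩
  obtain ⟨u, f2, f3, rfl⟩ := exists_eq_mixedOp_add_mixedDataFunctional ν l3 l5 F
  obtain ⟨w, hw⟩ := exists_isMixedSolution_mixedData hL hreg f2 f3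
  have hw' : C.mixedOp ν l3 l5 w = C.mixedDataFunctional f2 f3 :=
    isMixedSolution_iff_mixedOp_eq.1 hw
  exact ⟨u + w, by rw [map_add, hw']⟩

end DeRhamDomain

end VorticityMixed

theorem mainTheorem3_general
    {Ω : Set VorticityMixed.R3} (C : VorticityMixed.DeRhamDomain Ω)
    (ν : ℝ) (l3 l5 : VorticityMixed.L2Vec Ω →L[ℝ] VorticityMixed.L2Vec Ω)
    (hL : (C.primalOp ν l3 l5).IsInvertible) (hreg : C.PrimalRegularity ν l3 l5) :
    (∃ c : ℝ, 0 < c ∧ ∀ (f2 : VorticityMixed.L2Vec Ω) (f3 : VorticityMixed.L2Scal Ω),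
      ∃ u : C.MixedSpace, C.IsMixedSolution ν l3 l5 (C.mixedData f2 f3) u ∧
        (∀ u' : C.MixedSpace, C.IsMixedSolution ν l3 l5 (C.mixedData f2 f3) u' → u' = u) ∧
        C.normV u ≤ c * (‖f2‖ + ‖f3‖)) ∧
    (∃ c : ℝ, 0 < c ∧ ∀ F : StrongDual ℝ C.MixedSpace,
      ∃ u : C.MixedSpace, C.IsMixedSolution ν l3 l5 F u ∧
        (∀ u' : C.MixedSpace, C.IsMixedSolution ν l3 l5 F u' → u' = u) ∧
        C.normV u ≤ c * ‖F‖) := by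
  obtain ⟨c, hc, hsol⟩ := VorticityMixed.DeRhamDomain.exists_solution_bound_of_bijective_mixedOp
    (VorticityMixed.DeRhamDomain.mixedOp_bijective hL hreg)
  refine ⟨⟨c, hc, fun f2 f3 => ?_⟩, c, hc, hsol⟩
  obtain ⟨u, hu, huniq, hbound⟩ := hsol (C.mixedDataFunctional f2 f3)
  refine ⟨u, hu, huniq, hbound.trans ?_⟩
  gcongr
  exact VorticityMixed.DeRhamDomain.norm_mixedDataFunctional_le f2 f3

theorem mainTheorem3
    (Ω : Set VorticityMixed.R3) (hΩ : IsOpen Ω) (hbdd : Bornology.IsBounded Ω)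
    (C : VorticityMixed.DeRhamDomain Ω)
    (ν : ℝ) (hν : 0 < ν)
    (l3 l5 : VorticityMixed.L2Vec Ω →L[ℝ] VorticityMixed.L2Vec Ω)
    (hL : (C.primalOp ν l3 l5).IsInvertible)
    (hL' : (C.dualOp ν l3 l5).IsInvertible)
    (hreg : C.Regularity ν l3 l5) :
    -- unique solvability and stability for data `f₂ ∈ W²`, `f₃ ∈ W³`
    (∃ c : ℝ, 0 < c ∧ ∀ (f2 : VorticityMixed.L2Vec Ω) (f3 : VorticityMixed.L2Scal Ω),
      ∃ u : C.MixedSpace, C.IsMixedSolution ν l3 l5 (C.mixedData f2 f3) u ∧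
        (∀ u' : C.MixedSpace, C.IsMixedSolution ν l3 l5 (C.mixedData f2 f3) u' → u' = u) ∧
        C.normV u ≤ c * (‖f2‖ + ‖f3‖)) ∧
    -- the same for an arbitrary bounded functional on `V` as right-hand side
    (∃ c : ℝ, 0 < c ∧ ∀ F : StrongDual ℝ C.MixedSpace,
      ∃ u : C.MixedSpace, C.IsMixedSolution ν l3 l5 F u ∧
        (∀ u' : C.MixedSpace, C.IsMixedSolution ν l3 l5 F u' → u' = u) ∧
        C.normV u ≤ c * ‖F‖) :=
  mainTheorem3_general C ν l3 l5 hL hreg.1
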